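/- Let $q=p^h$ with $p$ an odd prime, and let $e$ be an integer with $0\le e\le h-1$ and $2e\mid h$ (so $e\ge 1$). For a linear code $\mathcal C\subseteq\mathbb F_q^n$ put $(\mathbf a,\mathbf b)_e=\sum_{i=1}^n a_ib_i^{p^e}$, let $\mathcal C^{\perp_e}=\{\mathbf a\in\mathbb F_q^n: (\mathbf a,\mathbf b)_e=0 \text{ for all } \mathbf b\in\mathcal C\}$ be its $e$-Galois dual and $\mathrm{Hull}_e(\mathcal C)=\mathcal C\cap\mathcal C^{\perp_e}$ its $e$-Galois hull; $\mathcal C$ is $e$-Galois self-orthogonal if $\mathrm{Hull}_e(\mathcal C)=\mathcal C$. An $[n,k,d]_q$ code is a $k$-dimensional subspace of $\mathbb F_q^n$ with minimum Hamming distance $d$, and it is MDS if $d=n-k+1$. An extended GRS code of length $n+1$ is a code $\{(v_1f(a_1),\dots,v_nf(a_n),f_{k-1}) : f\in\mathbb F_q[x],\ \deg f\le k-1\}$ with distinct $a_1,\dots,a_n\in\mathbb F_q$ and nonzero $v_1,\dots,v_n\in\mathbb F_q$, where $f_{k-1}$ is the coefficient of $x^{k-1}$ in $f$. Let $N$ and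 $K$ be positive integers that satisfy one of the following four conditions: (i) $N=tp^{h-e}+1$ and $K=\frac{p^e(tp^{h-2e}+1)}{p^e+1}$ for an integer $t$ with $1\le t\le p^e$ and $(p^e+1)\mid (tp^{h-2e}+1)$; (ii) $N=\frac{t(q-1)}{p^e-1}+2$ and $K=\frac{t(q-1)}{p^{2e}-1}+1$ for an integer $t$ with $1\le t\le p^e-1$; (iii) $N=r_1r_2+2$ and $K=\frac{r_1r_2}{p^e+1}+1$, where, for some positive integers $x_1,x_2$, $1\le r_1\le\frac{q-1}{\gcd(x_1,q-1)}$, $r_2=\frac{q-1}{\gcd(x_2,q-1)}$, $(q-1)\mid\mathrm{lcm}(x_1,x_2)$, $\gcd(x_2,q-1)\mid x_1(p^e-1)$ and $(p^e+1)\mid r_1r_2$; (iv) $N=rm+2$ and $K=\frac{rm}{p^e+1}+1$, where $m$ is a positive integer with $m\mid(q-1)$, $y=\frac{q-1}{p^e-1}$, $m_1=\frac{m}{\gcd(m,y)}$, $1\le r\le\frac{p^e-1}{m_1}$ and $(p^e+1)\mid rm$. Then: 1) there is an $[N,K,N-K+1]_q$ $e$-Galois self-orthogonal extended GRS code; 2)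 for every $s$ with $1\le s\le K-1$ there is an $[N-s,K-s,N-K+1]_q$ $e$-Galois self-orthogonal MDS code; 3) for every $s$ with $1\le s\le K$ and $s<N-K+1$ there is an $[N-s,K,N-s-K+1]_q$ MDS code whose $e$-Galois hull has dimension $K-s$. -/

import Mathlib

open Polynomial

/-- `C` is an `[n, k, d]` linear code: a `k`-dimensional subspace of `F ^ n` in which `d` is the
least Hamming distance between two distinct codewords. -/
def IsLinearCode {F : Type*} [Field F] [DecidableEq F] {n : ℕ}
    (C : Submodule F (Fin n → F)) (k d : ℕ) : Prop :=
  Module.finrank F C = k ∧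
    IsLeast {δ : ℕ | ∃ x ∈ C, ∃ y ∈ C, x ≠ y ∧ δ = hammingDist x y} d

/-- `C` is maximum distance separable: its parameters satisfy `d = n - k + 1`
(written without subtraction). -/
def IsMDS {F : Type*} [Field F] [DecidableEq F] {n : ℕ}
    (C : Submodule F (Fin n → F)) : Prop :=
  ∃ k d : ℕ, IsLinearCode C k d ∧ d + k = n + 1

/-- The `e`-Galois inner product `∑ i, a i * b i ^ (p ^ e)`. -/
def galoisInner {F : Type*} [Field F] {n : ℕ} (p e : ℕ) (a b : Fin n → F) : F :=
  ∑ i, a i * b i ^ (p ^ e)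

/-- The `e`-Galois dual code of `C`. -/
def galoisDual {F : Type*} [Field F] {n : ℕ} (p e : ℕ)
    (C : Submodule F (Fin n → F)) : Submodule F (Fin n → F) where
  carrier := {a | ∀ b ∈ C, galoisInner p e a b = 0}
  zero_mem' := by
    intro b _
    simp [galoisInner]
  add_mem' := by
    intro x y hx hy b hb
    have h1 := hx b hb
    have h2 := hy b hb
    simp only [galoisInner] at h1 h2 ⊢
    simp only [Pi.add_apply, add_mul, Finset.sum_add_distrib, h1, h2, add_zero]
  smul_mem' := by
    intro c x hx b hb
    have h1 := hx b hb
    simp only [galoisInner] at h1 ⊢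
    simp only [Pi.smul_apply, smul_eq_mul, mul_assoc, ← Finset.mul_sum, h1, mul_zero]

/-- The `e`-Galois hull of `C`. -/
def galoisHull {F : Type*} [Field F] {n : ℕ} (p e : ℕ)
    (C : Submodule F (Fin n → F)) : Submodule F (Fin n → F) :=
  C ⊓ galoisDual p e C

/-- `C` is `e`-Galois self-orthogonal. -/
def IsGaloisSelfOrthogonal {F : Type*} [Field F] {n : ℕ} (p e : ℕ)
    (C : Submodule F (Fin n → F)) : Prop :=
  galoisHull p e C = C

/-- The extended code `GRS_k(a, v, ∞)` of length `n + 1`: the words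
`(v₁ f(a₁), …, vₙ f(aₙ), f_{k-1})`, where `f` runs over the polynomials of degree at most `k - 1`
and `f_{k-1}` is the coefficient of `x ^ (k - 1)` in `f`. -/
def extendedGRS {F : Type*} [Field F] {n : ℕ} (k : ℕ) (a v : Fin n → F) :
    Submodule F (Fin (n + 1) → F) where
  carrier := {c | ∃ f : F[X], f.degree < (k : WithBot ℕ) ∧
    (∀ i : Fin n, c i.castSucc = v i * f.eval (a i)) ∧ c (Fin.last n) = f.coeff (k - 1)}
  zero_mem' := ⟨0, by simp, by simp, by simp⟩
  add_mem' := by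
    rintro x y ⟨f, hf, hx, hx'⟩ ⟨g, hg, hy, hy'⟩
    refine ⟨f + g, (degree_add_le f g).trans_lt (max_lt hf hg), fun i => ?_, ?_⟩
    · simp [hx, hy, mul_add]
    · simp [hx', hy']
  smul_mem' := by
    rintro c x ⟨f, hf, hx, hx'⟩
    refine ⟨c • f, (degree_smul_le c f).trans_lt hf, fun i => ?_, ?_⟩
    · simp [hx, mul_left_comm]
    · simp [hx']

/-- The code `C` of length `N` is an extended GRS code `GRS_k(a, v, ∞)`, for some distinct code
locators `a i` and some nonzero column multipliers `v i`. -/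
def IsExtendedGRS {F : Type*} [Field F] {N : ℕ} (C : Submodule F (Fin N → F)) (k : ℕ) : Prop :=
  ∃ (n : ℕ) (hN : n + 1 = N) (a v : Fin n → F), Function.Injective a ∧ (∀ i, v i ≠ 0) ∧
    ∀ c : Fin N → F, c ∈ C ↔ (fun i => c (Fin.cast hN i)) ∈ extendedGRS k a v

/-! The four families of parameters `(N, K)`, for `q = p ^ h`. If `p` is prime, `h` is positive
and `2 * e ∣ h`, then every division and subtraction of natural numbers below is exact. -/

/-- Parameters from the trace map to the field with `p ^ e` elements. -/
def TraceParams (p h e N K : ℕ) : Prop :=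
  ∃ t : ℕ, 1 ≤ t ∧ t ≤ p ^ e ∧ p ^ e + 1 ∣ t * p ^ (h - 2 * e) + 1 ∧
    N = t * p ^ (h - e) + 1 ∧
    K = p ^ e * (t * p ^ (h - 2 * e) + 1) / (p ^ e + 1)

/-- Parameters from the norm map to the field with `p ^ e` elements. -/
def NormParams (p h e N K : ℕ) : Prop :=
  ∃ t : ℕ, 1 ≤ t ∧ t ≤ p ^ e - 1 ∧
    N = t * (p ^ h - 1) / (p ^ e - 1) + 2 ∧
    K = t * (p ^ h - 1) / (p ^ (2 * e) - 1) + 1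

/-- Parameters from a direct product of two cyclic subgroups. -/
def DirectProductParams (p h e N K : ℕ) : Prop :=
  ∃ x₁ x₂ r₁ r₂ : ℕ, 0 < x₁ ∧ 0 < x₂ ∧
    1 ≤ r₁ ∧ r₁ ≤ (p ^ h - 1) / Nat.gcd x₁ (p ^ h - 1) ∧
    r₂ = (p ^ h - 1) / Nat.gcd x₂ (p ^ h - 1) ∧
    p ^ h - 1 ∣ Nat.lcm x₁ x₂ ∧ Nat.gcd x₂ (p ^ h - 1) ∣ x₁ * (p ^ e - 1) ∧
    p ^ e + 1 ∣ r₁ * r₂ ∧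
    N = r₁ * r₂ + 2 ∧ K = r₁ * r₂ / (p ^ e + 1) + 1

/-- Parameters from a coset decomposition of a cyclic group. -/
def CosetParams (p h e N K : ℕ) : Prop :=
  ∃ m m₁ y r : ℕ, m ∣ p ^ h - 1 ∧ y = (p ^ h - 1) / (p ^ e - 1) ∧ m₁ = m / Nat.gcd m y ∧
    1 ≤ r ∧ r ≤ (p ^ e - 1) / m₁ ∧
    p ^ e + 1 ∣ r * m ∧
    N = r * m + 2 ∧ K = r * m / (p ^ e + 1) + 1

/-! Let n = (p^e+1)(K-1)+1 and let f, g have degree at most K-1. Then f·g^(p^e) has degree at most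
n-1, and its coefficient at x^(n-1) is f_{K-1}·g_{K-1}^(p^e), the contribution of the last
coordinate to the Galois product. By Lagrange interpolation this coefficient is also ∑ u_i f(a_i)
g(a_i)^(p^e) with u_i = ∏_{j≠i} (a_i - a_j)⁻¹. Hence the extended code is self-orthogonal as soon as
v_i^(p^e+1) = -u_i (`isGaloisSelfOrthogonal_extendedGRS`). These equations are solvable when every
u_i lies in the field E with p^e elements: 2e ∣ h makes elements of E norms from its quadratic
extension inside F (`exists_pow_succ_eq`).

It remains to find n locators whose difference products lie in E. If they are the roots of a monic G
of degree n, the products are the values G'(a). With g the nodal polynomial of a set T ⊆ E, take G =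
g(Tr x) for family (i), where Tr' = 1, and G = x·g(x^m) for the other three families
(`exists_locators_of_trace`, `exists_locators_of_dvd`).

Claims 2 and 3 follow by shortening and puncturing this one code: both keep it MDS, and the hull of
the punctured code is the shortened code (`galoisHull_puncturedCode`). -/

/-! ### MDS codes: information sets, shortening, puncturing and the hull. -/

section LinearCodes

variable {F : Type*} [Field F]

/-- `C` has dimension `k` and every nonzero word of `C` has fewer than `k` zero coordinates. -/
def HasFewZeros [DecidableEq F] {n : ℕ} (C : Submodule F (Fin n → F)) (k : ℕ) : Prop :=
  Module.finrank F C = k ∧ ∀ c ∈ C, c ≠ 0 → (Finset.univ.filter fun i => c i = 0).card < k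

/-- The restriction of the words of `C` to the coordinates in the image of `σ`. -/
def restrictCoords {n m : ℕ} (C : Submodule F (Fin n → F)) (σ : Fin m → Fin n) :
    C →ₗ[F] (Fin m → F) :=
  (LinearMap.funLeft F F σ).domRestrict C

@[simp] lemma restrictCoords_apply {n m : ℕ} (C : Submodule F (Fin n → F)) (σ : Fin m → Fin n)
    (c : C) (j : Fin m) : restrictCoords C σ c j = (c : Fin n → F) (σ j) := rfl

/-- Extension of a word by `s` zero coordinates. -/
def appendZeros (n s : ℕ) : (Fin n → F) →ₗ[F] (Fin (n + s) → F) where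
  toFun c := Fin.append c 0
  map_add' x y := by
    ext i
    refine Fin.addCases (fun j => ?_) (fun j => ?_) i <;> simp
  map_smul' a x := by
    ext i
    refine Fin.addCases (fun j => ?_) (fun j => ?_) i <;> simp

@[simp] lemma appendZeros_castAdd (n s : ℕ) (c : Fin n → F) (i : Fin n) :
    appendZeros n s c (Fin.castAdd s i) = c i := by
  simp [appendZeros]

@[simp] lemma appendZeros_natAdd (n s : ℕ) (c : Fin n → F) (i : Fin s) :
    appendZeros n s c (Fin.natAdd n i) = 0 := by
  simp [appendZeros]

lemma appendZeros_injective (n s : ℕ) :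
    Function.Injective (appendZeros (F := F) n s) := by
  intro x y hxy
  ext i
  simpa using congrFun hxy (Fin.castAdd s i)

/-- The code obtained from `C` by shortening the last `s` coordinates. -/
def shortenedCode {n s : ℕ} (C : Submodule F (Fin (n + s) → F)) : Submodule F (Fin n → F) :=
  C.comap (appendZeros n s)

/-- The code obtained from `C` by puncturing the last `s` coordinates. -/
def puncturedCode {n s : ℕ} (C : Submodule F (Fin (n + s) → F)) : Submodule F (Fin n → F) :=
  C.map (LinearMap.funLeft F F (Fin.castAdd s))

lemma isGaloisSelfOrthogonal_iff {n p e : ℕ} {C : Submodule F (Fin n → F)} :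
    IsGaloisSelfOrthogonal p e C ↔ ∀ a ∈ C, ∀ b ∈ C, galoisInner p e a b = 0 :=
  inf_eq_left

lemma galoisInner_append {n s p e : ℕ} (a b : Fin (n + s) → F) :
    galoisInner p e a b =
      galoisInner p e (fun i => a (Fin.castAdd s i)) (fun i => b (Fin.castAdd s i)) +
        galoisInner p e (fun i => a (Fin.natAdd n i)) (fun i => b (Fin.natAdd n i)) := by
  simp only [galoisInner, Fin.sum_univ_add]

lemma IsGaloisSelfOrthogonal.shortenedCode {n s p e : ℕ} {C : Submodule F (Fin (n + s) → F)}
    (hC : IsGaloisSelfOrthogonal p e C) : IsGaloisSelfOrthogonal p e (shortenedCode C) := by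
  rw [isGaloisSelfOrthogonal_iff] at hC ⊢
  intro a ha b hb
  have := hC _ ha _ hb
  rw [galoisInner_append] at this
  simpa [galoisInner] using this

variable [DecidableEq F]

namespace HasFewZeros

variable {n k : ℕ} {C : Submodule F (Fin n → F)}

lemma restrictCoords_injective (hC : HasFewZeros C k) {σ : Fin k → Fin n}
    (hσ : Function.Injective σ) : Function.Injective (restrictCoords C σ) := by
  rw [injective_iff_map_eq_zero]
  intro c hc
  by_contra hne
  have hlt := hC.2 c c.2 (by simpa using hne)
  have hsub : Finset.univ.image σ ⊆ Finset.univ.filter fun i => (c : Fin n → F) i = 0 := by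
    intro i hi
    obtain ⟨j, -, rfl⟩ := Finset.mem_image.mp hi
    simpa using congrFun hc j
  have := Finset.card_le_card hsub
  rw [Finset.card_image_of_injective _ hσ, Finset.card_univ, Fintype.card_fin] at this
  omega

/-- Any k coordinates form an information set, since restriction to them is injective between spaces
of dimension k. Fewer coordinates are first enlarged to such a set. -/
lemma restrictCoords_surjective (hC : HasFewZeros C k) (hkn : k ≤ n) {s : ℕ} (hs : s ≤ k)
    {σ : Fin s → Fin n} (hσ : Function.Injective σ) :
    Function.Surjective (restrictCoords C σ) := by
  obtain ⟨J, hJ, hJk⟩ := Finset.exists_superset_card_eq (s := Finset.univ.image σ) (n := k)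
    (by rw [Finset.card_image_of_injective _ hσ]; simpa using hs) (by simpa using hkn)
  let ρ : Fin k ≃ J := (J.equivFinOfCardEq hJk).symm
  have hρ : Function.Injective fun i => (ρ i : Fin n) :=
    Subtype.val_injective.comp ρ.injective
  have hsurj : Function.Surjective (restrictCoords C fun i => (ρ i : Fin n)) :=
    (LinearMap.injective_iff_surjective_of_finrank_eq_finrank (by simp [hC.1])).mp
      (hC.restrictCoords_injective hρ)
  intro g
  have hmem : ∀ i, σ i ∈ J := fun i => hJ (Finset.mem_image_of_mem σ (Finset.mem_univ i))
  obtain ⟨c, hc⟩ := hsurj fun i => Function.extend σ g 0 (ρ i)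
  refine ⟨c, funext fun i => ?_⟩
  have := congrFun hc (ρ.symm ⟨σ i, hmem i⟩)
  simpa [hσ.extend_apply] using this

lemma isLinearCode (hC : HasFewZeros C k) (hk : 1 ≤ k) (hkn : k ≤ n) :
    IsLinearCode C k (n - k + 1) := by
  have hweight : ∀ x y : Fin n → F,
      hammingDist x y + (Finset.univ.filter fun i => (x - y) i = 0).card = n := by
    intro x y
    have := Finset.card_filter_add_card_filter_not (s := (Finset.univ : Finset (Fin n)))
      (fun i => x i ≠ y i)
    simpa [hammingDist, sub_eq_zero] using this
  refine ⟨hC.1, ?_, ?_⟩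
  · have hsurj : Function.Surjective (restrictCoords C (Fin.castLE hkn)) :=
      hC.restrictCoords_surjective hkn le_rfl (Fin.castLE_injective hkn)
    -- A word of minimum weight: it vanishes on k-1 coordinates of an information set and is 1 on
    -- the remaining one.
    obtain ⟨c, hc⟩ := hsurj fun i => if (i : ℕ) + 1 = k then 1 else 0
    have hc' : ∀ i : Fin k, (c : Fin n → F) (Fin.castLE hkn i) =
      if (i : ℕ) + 1 = k then 1 else 0 := fun i => congrFun hc i
    have hne : (c : Fin n → F) ≠ 0 := by
      intro h0
      have := hc' ⟨k - 1, by omega⟩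
      rw [h0, if_pos (by simp; omega)] at this
      exact zero_ne_one this
    refine ⟨c, c.2, 0, C.zero_mem, hne, ?_⟩
    have h1 := hC.2 c c.2 hne
    have h2 := hweight c 0
    have h3 : k - 1 ≤ (Finset.univ.filter fun i => (c : Fin n → F) i = 0).card := by
      have hinj : Function.Injective fun i : Fin (k - 1) =>
          Fin.castLE hkn (Fin.castLE (Nat.sub_le k 1) i) :=
        (Fin.castLE_injective hkn).comp (Fin.castLE_injective _)
      rw [← Fintype.card_fin (k - 1), ← Finset.card_univ,
        ← Finset.card_image_of_injective _ hinj]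
      refine Finset.card_le_card fun i hi => ?_
      obtain ⟨j, -, rfl⟩ := Finset.mem_image.mp hi
      rw [Finset.mem_filter]
      refine ⟨Finset.mem_univ _, ?_⟩
      rw [hc', if_neg]
      have := j.2
      simp
      omega
    rw [sub_zero] at h2
    omega
  · rintro d ⟨x, hx, y, hy, hxy, rfl⟩
    have h1 := hC.2 (x - y) (C.sub_mem hx hy) (sub_ne_zero.mpr hxy)
    have h2 := hweight x y
    omega

lemma isMDS (hC : HasFewZeros C k) (hk : 1 ≤ k) (hkn : k ≤ n) : IsMDS C :=
  ⟨k, n - k + 1, hC.isLinearCode hk hkn, by omega⟩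

variable {s : ℕ} {D : Submodule F (Fin (n + s) → F)}

lemma finrank_shortenedCode (hD : HasFewZeros D k) (hkn : k ≤ n + s) (hs : s ≤ k) :
    Module.finrank F (shortenedCode D) = k - s := by
  have hsurj := hD.restrictCoords_surjective hkn hs (Fin.natAdd_injective s n)
  have hker := (restrictCoords D (Fin.natAdd n (m := s))).finrank_range_add_finrank_ker
  rw [LinearMap.range_eq_top.mpr hsurj, finrank_top, hD.1, Module.finrank_fin_fun] at hker
  have hmap : (shortenedCode D).map (appendZeros n s) =
      (LinearMap.ker (restrictCoords D (Fin.natAdd n (m := s)))).map D.subtype := by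
    ext c
    constructor
    · rintro ⟨x, hx, rfl⟩
      refine ⟨⟨appendZeros n s x, hx⟩, ?_, rfl⟩
      rw [SetLike.mem_coe, LinearMap.mem_ker]
      ext j
      simp
    · rintro ⟨x, hx, rfl⟩
      have hx' : appendZeros n s (fun i => (x : Fin (n + s) → F) (Fin.castAdd s i)) = x := by
        ext i
        refine Fin.addCases (fun j => ?_) (fun j => ?_) i
        · simp
        · simpa using (congrFun (LinearMap.mem_ker.mp hx) j).symm
      refine ⟨_, ?_, hx'⟩
      change appendZeros n s _ ∈ D
      rw [hx']
      exact x.2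
  have h1 := (Submodule.equivMapOfInjective _ (appendZeros_injective n s)
    (shortenedCode D)).finrank_eq
  have h2 := (Submodule.equivMapOfInjective _ D.injective_subtype
    (LinearMap.ker (restrictCoords D (Fin.natAdd n (m := s))))).finrank_eq
  rw [h1, hmap, ← h2]
  omega

lemma shortenedCode (hD : HasFewZeros D k) (hkn : k ≤ n + s) (hs : s ≤ k) :
    HasFewZeros (shortenedCode D) (k - s) := by
  refine ⟨hD.finrank_shortenedCode hkn hs, fun c hc hne => ?_⟩
  have hlt := hD.2 (appendZeros n s c) hc (by
    rw [Ne, map_eq_zero_iff _ (appendZeros_injective n s)]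
    exact hne)
  have hcard : (Finset.univ.filter fun i => appendZeros n s c i = 0).card =
      (Finset.univ.filter fun i => c i = 0).card + s := by
    rw [Finset.card_filter, Fin.sum_univ_add, Finset.card_filter]
    simp
  omega

lemma puncturedCode (hD : HasFewZeros D k) (hs : k ≤ n) :
    HasFewZeros (puncturedCode D) k := by
  have hzero : ∀ c ∈ D, (LinearMap.funLeft F F (Fin.castAdd s)) c ≠ 0 →
      (Finset.univ.filter fun i => LinearMap.funLeft F F (Fin.castAdd s) c i = 0).card < k := by
    intro c hc hne
    refine lt_of_le_of_lt ?_ (hD.2 c hc fun h => hne (by rw [h, map_zero]))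
    rw [← Finset.card_image_of_injective _ (Fin.castAdd_injective n s)]
    refine Finset.card_le_card fun i hi => ?_
    obtain ⟨j, hj, rfl⟩ := Finset.mem_image.mp hi
    exact Finset.mem_filter.mpr ⟨Finset.mem_univ _, (Finset.mem_filter.mp hj).2⟩
  refine ⟨?_, ?_⟩
  -- Puncturing loses no dimension because the n ≥ k remaining coordinates contain an information
  -- set.
  · have hinj : Function.Injective (restrictCoords D (Fin.castAdd s (n := n))) := by
      have := hD.restrictCoords_injective
        (σ := fun i => Fin.castAdd s (Fin.castLE hs i))
        ((Fin.castAdd_injective n s).comp (Fin.castLE_injective hs))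
      intro x y hxy
      apply this
      ext i
      exact congrFun hxy (Fin.castLE hs i)
    have := LinearMap.finrank_range_of_inj hinj
    rw [hD.1, restrictCoords, LinearMap.range_domRestrict] at this
    exact this
  · rintro _ ⟨c, hc, rfl⟩ hne
    exact hzero c hc hne

end HasFewZeros

/-- The Galois hull of a punctured MDS self-orthogonal code is the shortened code. -/
lemma galoisHull_puncturedCode {n s k p e : ℕ} (hp : p ≠ 0) {C : Submodule F (Fin (n + s) → F)}
    (hC : HasFewZeros C k) (hkn : k ≤ n + s) (hs : s ≤ k)
    (hself : IsGaloisSelfOrthogonal p e C) :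
    galoisHull p e (puncturedCode C) = shortenedCode C := by
  rw [isGaloisSelfOrthogonal_iff] at hself
  ext c
  constructor
  · rintro ⟨⟨a, ha, rfl⟩, hdual⟩
    -- Pair `a` with a codeword `b` that is the j-th unit vector on the deleted coordinates. The
    -- total product vanishes by self-orthogonality and the part on the kept coordinates by duality,
    -- which leaves the j-th deleted entry of `a`.
    have hzero : ∀ j : Fin s, a (Fin.natAdd n j) = 0 := by
      intro j
      obtain ⟨b, hb⟩ := hC.restrictCoords_surjective hkn hs (Fin.natAdd_injective s n)
        (Pi.single j 1)
      have h1 := hself a ha b b.2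
      have h2 : galoisInner p e (fun i => a (Fin.castAdd s i))
        (fun i => (b : Fin (n + s) → F) (Fin.castAdd s i)) = 0 := hdual _ ⟨b, b.2, rfl⟩
      have hb' : (fun i => (b : Fin (n + s) → F) (Fin.natAdd n i)) = Pi.single j 1 := hb
      rw [galoisInner_append, h2, zero_add, hb', galoisInner, Finset.sum_eq_single j] at h1
      · simpa using h1
      · intro i _ hij
        simp [Pi.single_eq_of_ne hij, hp]
      · simp
    have happ : appendZeros n s (LinearMap.funLeft F F (Fin.castAdd s) a) = a := by
      ext i
      refine Fin.addCases (fun j => ?_) (fun j => ?_) i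
      · simp
      · simp [hzero]
    change appendZeros n s _ ∈ C
    rwa [happ]
  · intro hc
    have hres : LinearMap.funLeft F F (Fin.castAdd s) (appendZeros n s c) = c := by
      ext i
      simp
    refine ⟨⟨appendZeros n s c, hc, hres⟩, ?_⟩
    rintro _ ⟨b, hb, rfl⟩
    have := hself _ hc b hb
    rw [galoisInner_append] at this
    simpa [galoisInner] using this

end LinearCodes

/-! ### Extended GRS codes: the MDS property and self-orthogonality. -/

section ExtendedGRS

variable {F : Type*} [Field F] {n k : ℕ}

/-- The encoder of the extended GRS code. -/
def extendedGRSEncoder (k : ℕ) (a v : Fin n → F) : degreeLT F k →ₗ[F] (Fin (n + 1) → F) where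
  toFun f := Fin.snoc (fun i => v i * (f : F[X]).eval (a i)) ((f : F[X]).coeff (k - 1))
  map_add' f g := by
    ext i
    refine Fin.lastCases ?_ (fun j => ?_) i <;> simp [mul_add]
  map_smul' c f := by
    ext i
    refine Fin.lastCases ?_ (fun j => ?_) i <;> simp [mul_left_comm]

lemma range_extendedGRSEncoder (k : ℕ) (a v : Fin n → F) :
    LinearMap.range (extendedGRSEncoder k a v) = extendedGRS k a v := by
  ext c
  constructor
  · rintro ⟨f, rfl⟩
    exact ⟨f, mem_degreeLT.mp f.2, by simp [extendedGRSEncoder], by simp [extendedGRSEncoder]⟩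
  · rintro ⟨f, hf, h1, h2⟩
    refine ⟨⟨f, mem_degreeLT.mpr hf⟩, ?_⟩
    ext i
    refine Fin.lastCases ?_ (fun j => ?_) i
    · simp [extendedGRSEncoder, h2]
    · simp [extendedGRSEncoder, h1]

/-- A nonzero word of an extended GRS code of dimension `k` has fewer than `k` zeros. -/
lemma card_zeros_extendedGRSEncoder_lt [DecidableEq F] {a v : Fin n → F}
    (ha : Function.Injective a) (hv : ∀ i, v i ≠ 0) {f : degreeLT F k} (hf : f ≠ 0) :
    (Finset.univ.filter fun i => extendedGRSEncoder k a v f i = 0).card < k := by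
  obtain ⟨f, hdeg⟩ := f
  have hf0 : f ≠ 0 := by simpa using hf
  have hdeg' : f.natDegree < k := (natDegree_lt_iff_degree_lt hf0).mpr (mem_degreeLT.mp hdeg)
  have hroots : (Finset.univ.filter fun i => v i * f.eval (a i) = 0).card ≤ f.natDegree := by
    rw [← Finset.card_image_of_injective _ ha]
    refine (Finset.card_le_card (t := f.roots.toFinset) fun x hx => ?_).trans
      ((Multiset.toFinset_card_le _).trans (card_roots' f))
    obtain ⟨i, hi, rfl⟩ := Finset.mem_image.mp hx
    simpa [hf0, hv i] using hi
  have hsplit : (Finset.univ.filter fun i => extendedGRSEncoder k a v ⟨f, hdeg⟩ i = 0).card =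
      (Finset.univ.filter fun i => v i * f.eval (a i) = 0).card +
        if f.coeff (k - 1) = 0 then 1 else 0 := by
    rw [Finset.card_filter, Fin.sum_univ_castSucc, Finset.card_filter]
    simp [extendedGRSEncoder]
  rw [hsplit]
  -- A zero in the last coordinate costs one unit of degree, hence one possible root.
  split_ifs with h
  · have : f.natDegree ≠ k - 1 := by
      intro hk
      rw [← hk] at h
      exact hf0 (leadingCoeff_eq_zero.mp h)
    omega
  · omega

lemma hasFewZeros_extendedGRS [DecidableEq F] {a v : Fin n → F}
    (ha : Function.Injective a) (hv : ∀ i, v i ≠ 0) (hk : k ≤ n + 1) :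
    HasFewZeros (extendedGRS k a v) k := by
  rw [← range_extendedGRSEncoder]
  have hinj : Function.Injective (extendedGRSEncoder k a v) := by
    rw [injective_iff_map_eq_zero]
    intro f hf
    by_contra hne
    have := card_zeros_extendedGRSEncoder_lt ha hv hne
    simp [hf] at this
    omega
  refine ⟨?_, ?_⟩
  · rw [LinearMap.finrank_range_of_inj hinj, (degreeLTEquiv F k).finrank_eq,
      Module.finrank_fin_fun]
  · rintro _ ⟨f, rfl⟩ hne
    exact card_zeros_extendedGRSEncoder_lt ha hv fun h => hne (by rw [h, map_zero])

/-- The condition on the column multipliers under which an extended GRS code is self-orthogonal. -/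
lemma isGaloisSelfOrthogonal_extendedGRS {a v : Fin n → F} {p e : ℕ}
    (ha : Function.Injective a) (hk : 1 ≤ k) (hn : (p ^ e + 1) * (k - 1) + 1 = n)
    (hv : ∀ i, v i ^ (p ^ e + 1) = -(∏ j ∈ Finset.univ.erase i, (a i - a j))⁻¹) :
    IsGaloisSelfOrthogonal p e (extendedGRS k a v) := by
  rw [isGaloisSelfOrthogonal_iff]
  rintro x ⟨f, hf, hx, hx'⟩ y ⟨g, hg, hy, hy'⟩
  have hdeg : ∀ {f : F[X]}, f.degree < (k : WithBot ℕ) → f.natDegree ≤ k - 1 := by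
    intro f hf
    by_cases h0 : f = 0
    · simp [h0]
    · have := (natDegree_lt_iff_degree_lt h0).mpr hf
      omega
  have hgdeg : (g ^ p ^ e).natDegree ≤ p ^ e * (k - 1) := natDegree_pow_le_of_le _ (hdeg hg)
  have hcoeff : (f * g ^ p ^ e).coeff (n - 1) = f.coeff (k - 1) * g.coeff (k - 1) ^ p ^ e := by
    have : n - 1 = (k - 1) + p ^ e * (k - 1) := by rw [← hn, Nat.add_sub_cancel]; ring
    rw [this, coeff_mul_add_eq_of_natDegree_le (hdeg hf) hgdeg,
      coeff_pow_of_natDegree_le (hdeg hg)]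
  have hlt : (f * g ^ p ^ e).degree < ((Finset.univ : Finset (Fin n)).card : WithBot ℕ) := by
    have h1 : (f * g ^ p ^ e).natDegree ≤ (k - 1) + p ^ e * (k - 1) :=
      natDegree_mul_le_of_le (hdeg hf) hgdeg
    refine degree_le_natDegree.trans_lt ?_
    rw [Finset.card_univ, Fintype.card_fin]
    have h2 : (k - 1) + p ^ e * (k - 1) < n := by rw [← hn]; nlinarith
    exact_mod_cast h1.trans_lt h2
  -- The coefficient at x^(n-1) of a polynomial of degree below n is the weighted sum of its values
  -- at the n nodes.
  have hsum := Lagrange.coeff_eq_sum (v := a) ha.injOn hlt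
  rw [Finset.card_univ, Fintype.card_fin, hcoeff] at hsum
  rw [galoisInner, Fin.sum_univ_castSucc, hx', hy', hsum, ← Finset.sum_add_distrib]
  refine Finset.sum_eq_zero fun i _ => ?_
  rw [hx, hy, eval_mul, eval_pow]
  have : v i * eval (a i) f * (v i * eval (a i) g) ^ p ^ e =
      v i ^ (p ^ e + 1) * (eval (a i) f * eval (a i) g ^ p ^ e) := by ring
  rw [this, hv]
  ring

end ExtendedGRS

/-! ### The subfield fixed by the e-th Frobenius power, and norms. -/

section FixedField

variable {F : Type*} [Field F]

/-- The elements `x` with `x ^ (p ^ e) = x`. -/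
def frobeniusFixed (F : Type*) [Field F] (p e : ℕ) [ExpChar F p] : Subring F :=
  RingHom.eqLocus (iterateFrobenius F p e) (RingHom.id F)

lemma mem_frobeniusFixed {p e : ℕ} [ExpChar F p] {x : F} :
    x ∈ frobeniusFixed F p e ↔ x ^ p ^ e = x := Iff.rfl

lemma pow_sub_one_eq_one_of_pow_eq_self {x : F} {q : ℕ} (hq : 1 ≤ q) (hx : x ≠ 0)
    (h : x ^ q = x) : x ^ (q - 1) = 1 := by
  apply mul_right_cancel₀ hx
  rw [← pow_succ, Nat.sub_add_cancel hq, h, one_mul]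

variable [Fintype F]

lemma exists_isPrimitiveRoot_card_sub_one (F : Type*) [Field F] [Fintype F] :
    ∃ ζ : F, IsPrimitiveRoot ζ (Fintype.card F - 1) := by
  obtain ⟨g, hg⟩ := IsCyclic.exists_ofOrder_eq_natCard (α := Fˣ)
  refine ⟨g, ?_⟩
  rw [← Nat.card_eq_fintype_card, ← Nat.card_units, ← hg]
  exact IsPrimitiveRoot.coe_units_iff.mpr (IsPrimitiveRoot.orderOf g)

/-- A nonzero element of the field with `q` elements is a norm from a quadratic extension. -/
lemma exists_pow_succ_eq {q : ℕ} (hq : 2 ≤ q) (hcard : (q + 1) * (q - 1) ∣ Fintype.card F - 1)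
    {z : F} (hz : z ≠ 0) (hzq : z ^ q = z) : ∃ v : F, v ^ (q + 1) = z := by
  obtain ⟨ζ, hζ⟩ := exists_isPrimitiveRoot_card_sub_one F
  have hpos : 0 < Fintype.card F - 1 := Nat.sub_pos_of_lt Fintype.one_lt_card
  have : NeZero (Fintype.card F - 1) := ⟨hpos.ne'⟩
  obtain ⟨i, -, rfl⟩ := hζ.eq_pow_of_pow_eq_one (FiniteField.pow_card_sub_one_eq_one z hz)
  have h1 := pow_sub_one_eq_one_of_pow_eq_self (by omega) hz hzq
  rw [← pow_mul] at h1
  -- For z = ζ^i this reads (q+1)(q-1) ∣ i(q-1), so q+1 divides i.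
  have h2 := hcard.trans (hζ.dvd_of_pow_eq_one _ h1)
  obtain ⟨j, rfl⟩ := Nat.dvd_of_mul_dvd_mul_right (by omega) h2
  exact ⟨ζ ^ j, by rw [← pow_mul, mul_comm]⟩

end FixedField

/-! ### Locator sets whose difference products lie in the fixed field. -/

section Locators

variable {F : Type*} [Field F]

lemma eval_nodal_mem {T : Finset F} {E : Subring F} (hT : ∀ τ ∈ T, τ ∈ E) {x : F} (hx : x ∈ E) :
    (Lagrange.nodal T id).eval x ∈ E := by
  rw [Lagrange.eval_nodal]
  exact prod_mem fun τ hτ => sub_mem hx (hT τ hτ)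

lemma eval_derivative_nodal_mem [DecidableEq F] {T : Finset F} {E : Subring F} (hT : ∀ τ ∈ T, τ ∈ E) {x : F}
    (hx : x ∈ E) : (derivative (Lagrange.nodal T id)).eval x ∈ E := by
  rw [Lagrange.derivative_nodal, eval_finsetSum]
  exact sum_mem fun τ _ => eval_nodal_mem (fun σ hσ => hT σ (Finset.mem_of_mem_erase hσ)) hx

variable [DecidableEq F]

/-- A monic polynomial of degree |S| vanishing on S is the nodal polynomial of S. This permits
computing the products from a composite G without factoring it. -/
lemma prod_erase_sub_eq_eval_derivative {S : Finset F} {G : F[X]} (hG : G.Monic)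
    (hdeg : G.natDegree = S.card) (hroot : ∀ a ∈ S, G.eval a = 0) {a : F} (ha : a ∈ S) :
    ∏ b ∈ S.erase a, (a - b) = (derivative G).eval a := by
  have hGS : G = Lagrange.nodal S id := by
    refine eq_of_degree_sub_lt_of_eval_finset_eq S ?_ fun x hx => ?_
    · rw [← hdeg, ← degree_eq_natDegree hG.ne_zero]
      refine degree_sub_lt_left ?_ hG.ne_zero ?_
      · rw [Lagrange.degree_nodal, degree_eq_natDegree hG.ne_zero, hdeg]
      · rw [hG.leadingCoeff, Lagrange.nodal_monic.leadingCoeff]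
    · rw [hroot x hx]
      exact (Lagrange.eval_nodal_at_node (v := id) hx).symm
  rw [hGS]
  have := Lagrange.eval_nodal_derivative_eval_node_eq (v := id) ha
  rw [id] at this
  rw [this, Lagrange.eval_nodal]
  rfl

variable [Fintype F]

/-- Locators whose differences multiply into the field with `p ^ e` elements give a
self-orthogonal extended GRS code. -/
lemma exists_isGaloisSelfOrthogonal {p e k : ℕ} [ExpChar F p] (hodd : Odd p) (hq : 2 ≤ p ^ e)
    (hcard : (p ^ e + 1) * (p ^ e - 1) ∣ Fintype.card F - 1) (hk : 1 ≤ k) (S : Finset F)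
    (hS : (p ^ e + 1) * (k - 1) + 1 = S.card)
    (hprod : ∀ a ∈ S, ∏ b ∈ S.erase a, (a - b) ∈ frobeniusFixed F p e) :
    ∃ C : Submodule F (Fin (S.card + 1) → F),
      IsExtendedGRS C k ∧ HasFewZeros C k ∧ IsGaloisSelfOrthogonal p e C := by
  let σ : Fin S.card ≃ S := S.equivFin.symm
  let a : Fin S.card → F := fun i => σ i
  have ha : Function.Injective a := Subtype.val_injective.comp σ.injective
  have himage : ∀ i, ∏ j ∈ Finset.univ.erase i, (a i - a j) = ∏ b ∈ S.erase (a i), (a i - b) := by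
    intro i
    rw [← Finset.prod_image (s := Finset.univ.erase i) (g := a) (f := fun b => a i - b) ha.injOn,
      Finset.image_erase ha]
    congr
    ext x
    simp only [Finset.mem_image, Finset.mem_univ, true_and]
    refine ⟨?_, fun hx => ⟨σ.symm ⟨x, hx⟩, by simp [a]⟩⟩
    rintro ⟨j, rfl⟩
    exact (σ j).2
  have hex : ∀ i, ∃ v : F, v ^ (p ^ e + 1) = -(∏ j ∈ Finset.univ.erase i, (a i - a j))⁻¹ := by
    intro i
    have hne : ∏ j ∈ Finset.univ.erase i, (a i - a j) ≠ 0 :=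
      Finset.prod_ne_zero_iff.mpr fun j hj =>
        sub_ne_zero.mpr fun h => (Finset.ne_of_mem_erase hj) (ha h).symm
    refine exists_pow_succ_eq hq hcard (neg_ne_zero.mpr (inv_ne_zero hne)) ?_
    -- Fixed elements are closed under inversion, and under negation because p^e is odd.
    have := mem_frobeniusFixed.mp (hprod (a i) (σ i).2)
    rw [hodd.pow.neg_pow, inv_pow, himage, this]
  choose v hv using hex
  have hv0 : ∀ i, v i ≠ 0 := by
    intro i h0
    have h := hv i
    rw [h0, zero_pow (Nat.succ_ne_zero _), eq_comm, neg_eq_zero, inv_eq_zero] at h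
    exact (Finset.prod_ne_zero_iff.mpr fun j hj =>
        sub_ne_zero.mpr fun h => (Finset.ne_of_mem_erase hj) (ha h).symm) h
  refine ⟨extendedGRS k a v, ⟨S.card, rfl, a, v, ha, hv0, fun c => Iff.rfl⟩,
    hasFewZeros_extendedGRS ha hv0 ?_, isGaloisSelfOrthogonal_extendedGRS ha hk hS hv⟩
  have : k - 1 ≤ (p ^ e + 1) * (k - 1) := Nat.le_mul_of_pos_left _ (Nat.succ_pos _)
  omega

/-- The locators `0` and the `m`-th roots of the `r` elements `(ζ ^ l) ^ i`. -/
lemma exists_locators_of_dvd {p e l m r : ℕ} [ExpChar F p]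
    (hml : m ∣ l) (hl : l ∣ Fintype.card F - 1)
    (hl' : Fintype.card F - 1 ∣ l * (p ^ e - 1)) (hr : r ≤ (Fintype.card F - 1) / l) :
    ∃ S : Finset F, S.card = r * m + 1 ∧
      ∀ a ∈ S, ∏ b ∈ S.erase a, (a - b) ∈ frobeniusFixed F p e := by
  obtain ⟨ζ, hζ⟩ := exists_isPrimitiveRoot_card_sub_one F
  have hpos : 0 < Fintype.card F - 1 := Nat.sub_pos_of_lt Fintype.one_lt_card
  have hmpos : 0 < m := Nat.pos_of_dvd_of_pos (hml.trans hl) hpos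
  have hζ0 : ζ ≠ 0 := hζ.ne_zero hpos.ne'
  have hζl : IsPrimitiveRoot (ζ ^ l) ((Fintype.card F - 1) / l) :=
    hζ.pow hpos (Nat.mul_div_cancel' hl).symm
  obtain ⟨c, hc⟩ := hml.trans hl
  have hζm : IsPrimitiveRoot (ζ ^ c) m := hζ.pow hpos (hc.trans (mul_comm _ _))
  have hpe : 1 ≤ p ^ e := Nat.one_le_pow _ _ (expChar_pos F p)
  let T : Finset F := (Finset.range r).image fun i => (ζ ^ l) ^ i
  have hTcard : T.card = r := by
    rw [Finset.card_image_of_injOn, Finset.card_range]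
    intro i hi j hj hij
    exact hζl.pow_inj ((Finset.mem_range.mp hi).trans_le hr) ((Finset.mem_range.mp hj).trans_le hr)
      hij
  have hT0 : ∀ τ ∈ T, τ ≠ 0 := by
    intro τ hτ
    obtain ⟨i, -, rfl⟩ := Finset.mem_image.mp hτ
    exact pow_ne_zero _ (pow_ne_zero _ hζ0)
  have hTE : ∀ τ ∈ T, τ ∈ frobeniusFixed F p e := by
    intro τ hτ
    obtain ⟨i, -, rfl⟩ := Finset.mem_image.mp hτ
    refine pow_mem ?_ i
    have h1 : ζ ^ (l * (p ^ e - 1)) = 1 := (hζ.pow_eq_one_iff_dvd _).mpr hl'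
    rw [mem_frobeniusFixed, ← Nat.sub_add_cancel hpe, pow_succ, ← pow_mul, h1, one_mul]
  -- As m ∣ l, every τ is an m-th power; with a primitive m-th root of unity in F, its fibre under x
  -- ↦ x^m has exactly m elements.
  have hTpow : ∀ τ ∈ T, ∃ α, α ^ m = τ := by
    intro τ hτ
    obtain ⟨i, -, rfl⟩ := Finset.mem_image.mp hτ
    obtain ⟨d, rfl⟩ := hml
    exact ⟨ζ ^ (d * i), by rw [← pow_mul, ← pow_mul]; congr 1; ring⟩
  have hfib : ∀ τ ∈ T, (Finset.univ.filter fun x : F => x ^ m = τ).card = m := by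
    intro τ hτ
    have h1 := hζm.card_nthRoots τ
    rw [if_pos (hTpow τ hτ)] at h1
    rw [← Multiset.toFinset_card_of_nodup (hζm.nthRoots_nodup (hT0 τ hτ))] at h1
    refine Eq.trans (congrArg Finset.card ?_) h1
    ext x
    simp [mem_nthRoots hmpos]
  let S : Finset F := insert 0 (Finset.univ.filter fun x : F => x ^ m ∈ T)
  have hScard : S.card = r * m + 1 := by
    rw [Finset.card_insert_of_notMem, Finset.card_eq_sum_card_fiberwise
      (f := fun x : F => x ^ m) (t := T) (fun x hx => by simpa using hx)]
    · congr 1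
      rw [← hTcard, ← smul_eq_mul, ← Finset.sum_const]
      refine Finset.sum_congr rfl fun τ hτ => ?_
      rw [Finset.filter_filter]
      refine Eq.trans (congrArg Finset.card ?_) (hfib τ hτ)
      refine Finset.filter_congr fun x _ => ⟨fun h => h.2, fun h => ⟨h ▸ hτ, h⟩⟩
    · intro h
      refine hT0 _ (Finset.mem_filter.mp h).2 ?_
      exact zero_pow hmpos.ne'
  -- The factor X, which adds the locator 0, turns m·a^(m-1) in the derivative into m·a^m, which is
  -- fixed even when a is not.
  let G : F[X] := X * (Lagrange.nodal T id).comp (X ^ m)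
  have hmonic : ((Lagrange.nodal T id).comp (X ^ m : F[X])).Monic :=
    Lagrange.nodal_monic.comp (monic_X_pow m) (by simpa using hmpos.ne')
  refine ⟨S, hScard, fun a ha => ?_⟩
  rw [prod_erase_sub_eq_eval_derivative (G := G) (monic_X.mul hmonic) ?_ ?_ ha]
  · have haE : a ^ m ∈ frobeniusFixed F p e := by
      rcases Finset.mem_insert.mp ha with rfl | ha
      · rw [zero_pow hmpos.ne']
        exact zero_mem _
      · exact hTE _ (Finset.mem_filter.mp ha).2
    have : (derivative G).eval a = (Lagrange.nodal T id).eval (a ^ m) +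
        m * a ^ m * (derivative (Lagrange.nodal T id)).eval (a ^ m) := by
      obtain ⟨d, rfl⟩ := Nat.exists_eq_succ_of_ne_zero hmpos.ne'
      simp [G, derivative_comp]
      ring
    rw [this]
    exact add_mem (eval_nodal_mem hTE haE)
      (mul_mem (mul_mem (natCast_mem _ _) haE) (eval_derivative_nodal_mem hTE haE))
  · rw [natDegree_mul X_ne_zero hmonic.ne_zero, natDegree_X, natDegree_comp,
      Lagrange.natDegree_nodal, natDegree_X_pow, hTcard, hScard, add_comm]
  · intro x hx
    rcases Finset.mem_insert.mp hx with rfl | hx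
    · simp [G]
    · have := Lagrange.eval_nodal_at_node (v := id) (Finset.mem_filter.mp hx).2
      rw [id] at this
      simp [G, this]

/-- The fibres over `T` of the trace to the field with `q` elements, as locators. -/
lemma exists_locators_of_trace {p e d t : ℕ} [Fact p.Prime] [CharP F p] (he : 1 ≤ e)
    (hF : Fintype.card F = (p ^ e) ^ (d + 1)) (ht : t ≤ p ^ e) :
    ∃ S : Finset F, S.card = t * (p ^ e) ^ d ∧
      ∀ a ∈ S, ∏ b ∈ S.erase a, (a - b) ∈ frobeniusFixed F p e := by
  set q := p ^ e with hq
  have hq2 : 2 ≤ q := (Fact.out : p.Prime).two_le.trans (Nat.le_self_pow (by omega) p)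
  let L : F[X] := ∑ i ∈ Finset.range (d + 1), X ^ q ^ i
  have hLlt : (∑ i ∈ Finset.range d, (X : F[X]) ^ q ^ i).degree < (q ^ d : ℕ) := by
    refine (degree_sum_le _ _).trans_lt ?_
    rw [Finset.sup_lt_iff (WithBot.bot_lt_coe _)]
    intro i hi
    rw [degree_X_pow]
    exact_mod_cast Nat.pow_lt_pow_right hq2 (Finset.mem_range.mp hi)
  have hLeq : L = X ^ q ^ d + ∑ i ∈ Finset.range d, X ^ q ^ i := by
    rw [add_comm]
    exact Finset.sum_range_succ _ _
  have hLmonic : L.Monic := by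
    rw [hLeq]
    exact monic_X_pow_add hLlt
  have hLdeg : L.natDegree = q ^ d := by
    rw [hLeq]
    exact natDegree_eq_of_degree_eq_some (by
      rw [degree_add_eq_left_of_degree_lt (by rwa [degree_X_pow]), degree_X_pow])
  have hqd : 0 < q ^ d := Nat.pow_pos (by omega)
  have hLder : derivative L = 1 := by
    have hq0 : (q : F) = 0 := by
      rw [hq, Nat.cast_pow, CharP.cast_eq_zero, zero_pow (by omega)]
    simp only [L, Finset.sum_range_succ', derivative_add, derivative_sum]
    rw [Finset.sum_eq_zero]
    · simp
    · intro i _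
      simp [derivative_X_pow, hq0]
  have hLfix : ∀ x : F, L.eval x ∈ frobeniusFixed F p e := by
    intro x
    have hx : x ^ q ^ (d + 1) = x := by rw [← hF, FiniteField.pow_card]
    have h1 : L.eval x = ∑ i ∈ Finset.range (d + 1), x ^ q ^ i := by
      simp [L, eval_finsetSum]
    -- Raising to the power q shifts the terms cyclically, since x^(q^(d+1)) = x.
    rw [mem_frobeniusFixed, h1, sum_pow_char_pow, Finset.sum_range_succ, Finset.sum_range_succ',
      ← hq, ← pow_mul, ← pow_succ, hx]
    simp [← pow_mul, ← pow_succ]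
  let B : Finset F := Finset.univ.filter fun x => x ^ q = x
  have hBcard : B.card ≤ q := by
    have hne : (X ^ q - X : F[X]) ≠ 0 := FiniteField.X_pow_card_sub_X_ne_zero F (by omega)
    have hdeg := FiniteField.X_pow_card_sub_X_natDegree_eq F (p := q) (by omega)
    refine (Finset.card_le_card (t := (X ^ q - X : F[X]).roots.toFinset) fun x hx => ?_).trans
      ((Multiset.toFinset_card_le _).trans ((card_roots' _).trans hdeg.le))
    have hx' : x ^ q = x := (Finset.mem_filter.mp hx).2
    simp [hne, hx']
  have hfible : ∀ τ ∈ B, (Finset.univ.filter fun x => L.eval x = τ).card ≤ q ^ d := by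
    intro τ _
    have hne : L - C τ ≠ 0 := by
      intro h
      have := congrArg natDegree (sub_eq_zero.mp h)
      rw [hLdeg, natDegree_C] at this
      omega
    refine (Finset.card_le_card (t := (L - C τ).roots.toFinset) fun x hx => ?_).trans
      ((Multiset.toFinset_card_le _).trans ((card_roots' _).trans ?_))
    · have hx' : L.eval x = τ := (Finset.mem_filter.mp hx).2
      simp [hne, hx']
    · rw [natDegree_sub_C, hLdeg]
  have hsum : Fintype.card F = ∑ τ ∈ B, (Finset.univ.filter fun x => L.eval x = τ).card :=
    Finset.card_eq_sum_card_fiberwise fun x _ =>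
      Finset.mem_coe.mpr (Finset.mem_filter.mpr ⟨Finset.mem_univ _, hLfix x⟩)
  -- The q^(d+1) elements of F lie in at most q fibres of at most q^d elements each, so both bounds
  -- are equalities.
  have hle := Finset.sum_le_sum hfible
  rw [← hsum, hF, Finset.sum_const, smul_eq_mul, pow_succ, mul_comm] at hle
  have hBq : B.card = q := le_antisymm hBcard (Nat.le_of_mul_le_mul_right hle hqd)
  have hfib : ∀ τ ∈ B, (Finset.univ.filter fun x => L.eval x = τ).card = q ^ d := by
    refine (Finset.sum_eq_sum_iff_of_le hfible).mp ?_
    rw [← hsum, hF, Finset.sum_const, smul_eq_mul, hBq, pow_succ, mul_comm]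
  obtain ⟨T, hTB, hTcard⟩ := Finset.exists_subset_card_eq (ht.trans hBq.ge)
  have hTE : ∀ τ ∈ T, τ ∈ frobeniusFixed F p e := fun τ hτ => (Finset.mem_filter.mp (hTB hτ)).2
  let S : Finset F := Finset.univ.filter fun x => L.eval x ∈ T
  have hScard : S.card = t * q ^ d := by
    rw [Finset.card_eq_sum_card_fiberwise (f := fun x : F => L.eval x) (t := T)
      (fun x hx => by simpa [S] using hx), ← hTcard, ← smul_eq_mul, ← Finset.sum_const]
    refine Finset.sum_congr rfl fun τ hτ => ?_
    rw [Finset.filter_filter, ← hfib τ (hTB hτ)]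
    congr 1
    exact Finset.filter_congr fun x _ => ⟨fun h => h.2, fun h => ⟨h ▸ hτ, h⟩⟩
  refine ⟨S, hScard, fun a ha => ?_⟩
  rw [prod_erase_sub_eq_eval_derivative (G := (Lagrange.nodal T id).comp L)
    (Lagrange.nodal_monic.comp hLmonic (by omega)) ?_ ?_ ha]
  · rw [derivative_comp, hLder, one_mul, eval_comp]
    exact eval_derivative_nodal_mem hTE (hLfix a)
  · rw [natDegree_comp, Lagrange.natDegree_nodal, hLdeg, hTcard, hScard]
  · intro x hx
    rw [eval_comp]
    exact Lagrange.eval_nodal_at_node (v := id) (Finset.mem_filter.mp hx).2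

end Locators

/-! ### From locators to the three claims. -/

lemma exists_codes_of_locators {F : Type*} [Field F] [Fintype F] [DecidableEq F]
    {p e h N K : ℕ} [Fact p.Prime] [CharP F p] (hodd : Odd p) (hF : Fintype.card F = p ^ h)
    (he : 2 * e ∣ h) (he1 : 1 ≤ e) (hK : 1 ≤ K) (S : Finset F) (hN : N = S.card + 1)
    (hS : (p ^ e + 1) * (K - 1) + 1 = S.card)
    (hprod : ∀ a ∈ S, ∏ b ∈ S.erase a, (a - b) ∈ frobeniusFixed F p e) :
    (∃ C : Submodule F (Fin N → F),
      IsExtendedGRS C K ∧ IsLinearCode C K (N - K + 1) ∧ IsGaloisSelfOrthogonal p e C) ∧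
    (∀ s : ℕ, 1 ≤ s → s ≤ K - 1 →
      ∃ C : Submodule F (Fin (N - s) → F),
        IsLinearCode C (K - s) (N - K + 1) ∧ IsMDS C ∧ IsGaloisSelfOrthogonal p e C) ∧
    (∀ s : ℕ, 1 ≤ s → s ≤ K → s < N - K + 1 →
      ∃ C : Submodule F (Fin (N - s) → F),
        IsLinearCode C K (N - s - K + 1) ∧ IsMDS C ∧
          Module.finrank F (galoisHull p e C) = K - s) := by
  have hp : p.Prime := Fact.out
  have hq2 : 2 ≤ p ^ e := hp.two_le.trans (Nat.le_self_pow (by omega) p)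
  have hcard : (p ^ e + 1) * (p ^ e - 1) ∣ Fintype.card F - 1 := by
    have h1 : (p ^ e + 1) * (p ^ e - 1) = p ^ (2 * e) - 1 := by
      rw [mul_comm 2 e, pow_mul, ← Nat.sq_sub_sq, one_pow]
    rw [h1, hF]
    exact Nat.pow_sub_one_dvd_pow_sub_one p he
  have hex := exists_isGaloisSelfOrthogonal hodd hq2 hcard hK S hS hprod
  rw [← hN] at hex
  obtain ⟨C, hGRS, hC, hself⟩ := hex
  have hKN : K ≤ N := by
    have : K - 1 ≤ (p ^ e + 1) * (K - 1) := Nat.le_mul_of_pos_left _ (Nat.succ_pos _)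
    omega
  refine ⟨⟨C, hGRS, hC.isLinearCode hK hKN, hself⟩, ?_, ?_⟩
  · intro s _ hs
    obtain ⟨n, rfl⟩ : ∃ n, N = n + s := ⟨N - s, by omega⟩
    rw [Nat.add_sub_cancel]
    have hD := hC.shortenedCode hKN (by omega)
    have hlin := hD.isLinearCode (by omega) (by omega)
    refine ⟨shortenedCode C, ?_, hD.isMDS (by omega) (by omega), hself.shortenedCode⟩
    convert hlin using 1
    omega
  · intro s _ hsK hs
    obtain ⟨n, rfl⟩ : ∃ n, N = n + s := ⟨N - s, by omega⟩
    rw [Nat.add_sub_cancel]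
    -- The bound s < N-K+1 leaves at least K coordinates.
    have hD := hC.puncturedCode (s := s) (n := n) (by omega)
    refine ⟨puncturedCode C, hD.isLinearCode hK (by omega), hD.isMDS hK (by omega), ?_⟩
    rw [galoisHull_puncturedCode hp.ne_zero hC hKN hsK hself]
    exact hC.finrank_shortenedCode hKN hsK

/-! ### Arithmetic of the four parameter families. -/

/-- If `b ∣ M` and `M ∣ lcm (a, b)`, then `a` is a multiple of `M / b`. -/
lemma div_dvd_of_dvd_lcm {M a b : ℕ} (hb : b ∣ M) (hM : 0 < M) (hlcm : M ∣ Nat.lcm a b) :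
    M / b ∣ a := by
  obtain ⟨c, rfl⟩ := hb
  have hb0 : 0 < b := Nat.pos_of_mul_pos_right hM
  rw [Nat.mul_div_cancel_left c hb0]
  refine Nat.dvd_of_mul_dvd_mul_left hb0 (hlcm.trans (Nat.lcm_dvd (Dvd.intro_left b rfl) ?_))
  exact Dvd.intro a rfl

/-- An instance of distributivity of gcd over lcm. It allows x₁ and x₂ of family (iii) to be
replaced by divisors of q-1. -/
lemma dvd_lcm_gcd_gcd {M a b : ℕ} (hM : 0 < M) (h : M ∣ Nat.lcm a b) :
    M ∣ Nat.lcm (Nat.gcd a M) (Nat.gcd b M) := by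
  set D := Nat.gcd (Nat.gcd a M) (Nat.gcd b M) with hD
  have hDpos : 0 < D := Nat.gcd_pos_of_pos_left _ (Nat.gcd_pos_of_pos_right _ hM)
  have hDa : D ∣ a := (Nat.gcd_dvd_left _ _).trans (Nat.gcd_dvd_left _ _)
  have hDb : D ∣ b := (Nat.gcd_dvd_right _ _).trans (Nat.gcd_dvd_left _ _)
  have hDM : D ∣ M := (Nat.gcd_dvd_left _ _).trans (Nat.gcd_dvd_right _ _)
  refine Nat.dvd_of_mul_dvd_mul_left hDpos ?_
  rw [hD, Nat.gcd_mul_lcm, ← hD, ← Nat.gcd_mul_right a (Nat.gcd b M) M]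
  refine Nat.dvd_gcd ?_ ?_
  · rw [← Nat.gcd_mul_left]
    refine Nat.dvd_gcd ?_ (Nat.mul_dvd_mul_right hDa M)
    rw [← Nat.gcd_mul_lcm a b]
    exact Nat.mul_dvd_mul (Nat.dvd_gcd hDa hDb) h
  · rw [mul_comm]
    exact Nat.mul_dvd_mul_left M (Nat.dvd_gcd hDb hDM)

theorem mainTheorem10 {F : Type*} [Field F] [Fintype F] [DecidableEq F]
    (p h e N K : ℕ) (hp : p.Prime) (hp_odd : Odd p) (hF : Fintype.card F = p ^ h)
    (he : 2 * e ∣ h)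
    (hNK : TraceParams p h e N K ∨ NormParams p h e N K ∨
      DirectProductParams p h e N K ∨ CosetParams p h e N K) :
    (∃ C : Submodule F (Fin N → F),
      IsExtendedGRS C K ∧ IsLinearCode C K (N - K + 1) ∧ IsGaloisSelfOrthogonal p e C) ∧
    (∀ s : ℕ, 1 ≤ s → s ≤ K - 1 →
      ∃ C : Submodule F (Fin (N - s) → F),
        IsLinearCode C (K - s) (N - K + 1) ∧ IsMDS C ∧ IsGaloisSelfOrthogonal p e C) ∧
    (∀ s : ℕ, 1 ≤ s → s ≤ K → s < N - K + 1 →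
      ∃ C : Submodule F (Fin (N - s) → F),
        IsLinearCode C K (N - s - K + 1) ∧ IsMDS C ∧
          Module.finrank F (galoisHull p e C) = K - s) := by
  have : Fact p.Prime := ⟨hp⟩
  have : CharP F p := charP_of_card_eq_prime_pow hF
  have hF1 : 1 < p ^ h := hF ▸ Fintype.one_lt_card
  have hpos : 0 < p ^ h - 1 := Nat.sub_pos_of_lt hF1
  have hh : h ≠ 0 := by
    rintro rfl
    simp at hF1
  have he1 : 1 ≤ e := by
    rw [Nat.one_le_iff_ne_zero]
    rintro rfl
    exact hh (by simpa using he)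
  have hq2 : 2 ≤ p ^ e := hp.two_le.trans (Nat.le_self_pow (by omega) p)
  have hQpos : 0 < p ^ e - 1 := by omega
  have hdvd : p ^ e - 1 ∣ p ^ h - 1 :=
    Nat.pow_sub_one_dvd_pow_sub_one p ((Dvd.intro_left 2 rfl).trans he)
  suffices hloc : ∃ S : Finset F, N = S.card + 1 ∧ 1 ≤ K ∧ (p ^ e + 1) * (K - 1) + 1 = S.card ∧
      ∀ a ∈ S, ∏ b ∈ S.erase a, (a - b) ∈ frobeniusFixed F p e by
    obtain ⟨S, hN, hK, hS, hprod⟩ := hloc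
    exact exists_codes_of_locators hp_odd hF he he1 hK S hN hS hprod
  -- Families (ii), (iii) and (iv) differ only in the choice of l and m here.
  have hmult : ∀ l m r : ℕ, m ∣ l → l ∣ p ^ h - 1 → p ^ h - 1 ∣ l * (p ^ e - 1) →
      r ≤ (p ^ h - 1) / l → p ^ e + 1 ∣ r * m → N = r * m + 2 →
      K = r * m / (p ^ e + 1) + 1 →
      ∃ S : Finset F, N = S.card + 1 ∧ 1 ≤ K ∧ (p ^ e + 1) * (K - 1) + 1 = S.card ∧
        ∀ a ∈ S, ∏ b ∈ S.erase a, (a - b) ∈ frobeniusFixed F p e := by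
    intro l m r hml hl hl' hr hdiv hN hK
    rw [← hF] at hl hl' hr
    obtain ⟨S, hS, hprod⟩ := exists_locators_of_dvd hml hl hl' hr
    refine ⟨S, by omega, hK ▸ Nat.succ_pos _, ?_, hprod⟩
    rw [hS, hK, Nat.add_sub_cancel, Nat.mul_div_cancel' hdiv]
  rcases hNK with ⟨t, -, ht, hdiv, hN, hK⟩ | ⟨t, -, ht, hN, hK⟩ |
    ⟨x₁, x₂, r₁, r₂, -, -, -, hr₁, rfl, hlcm, hx, hdiv, hN, hK⟩ |
    ⟨m, m₁, y, r, hm, rfl, rfl, -, hr, hdiv, hN, hK⟩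
  · obtain ⟨d, rfl⟩ := he
    obtain ⟨c, hc⟩ := hdiv
    have hd : d ≠ 0 := by
      rintro rfl
      simp at hh
    obtain ⟨d', rfl⟩ := Nat.exists_eq_succ_of_ne_zero hd
    have h1 : 2 * e * d'.succ - 2 * e = 2 * e * d' := by rw [Nat.mul_succ, Nat.add_sub_cancel]
    have h2 : 2 * e * d'.succ - e = e * (2 * d' + 1) := by
      rw [Nat.mul_succ]
      have : e * (2 * d' + 1) = 2 * e * d' + e := by ring
      omega
    have hF' : Fintype.card F = (p ^ e) ^ (2 * d' + 1 + 1) := by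
      rw [hF, ← pow_mul]
      congr 1
      simp only [Nat.succ_eq_add_one]
      ring
    obtain ⟨S, hS, hprod⟩ := exists_locators_of_trace he1 hF' ht
    rw [h1] at hc hK
    rw [h2, pow_mul] at hN
    have hKc : K = p ^ e * c := by
      rw [hK, hc, mul_left_comm, Nat.mul_div_cancel_left _ (Nat.succ_pos _)]
    have hc0 : 0 < c := by
      rcases Nat.eq_zero_or_pos c with rfl | h0
      · omega
      · exact h0
    have hK1 : 1 ≤ K := hKc ▸ Nat.mul_pos (by omega) hc0
    refine ⟨S, by omega, hK1, ?_, hprod⟩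
    -- With K = p^e·c, (p^e+1)K = p^e(t·p^(h-2e)+1) = |S| + p^e, which is the required length
    -- relation.
    have h3 : S.card + p ^ e = (p ^ e + 1) * K := by
      rw [hS, hKc, mul_left_comm, ← hc, mul_assoc 2 e d', mul_left_comm 2 e d', pow_mul]
      ring
    obtain ⟨K', rfl⟩ : ∃ K', K = K' + 1 := ⟨K - 1, by omega⟩
    rw [Nat.add_sub_cancel]
    rw [mul_add, mul_one] at h3
    omega
  · have hmy : (p ^ h - 1) / (p ^ e - 1) * (p ^ e - 1) = p ^ h - 1 := Nat.div_mul_cancel hdvd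
    have hypos : 0 < (p ^ h - 1) / (p ^ e - 1) := Nat.div_pos (Nat.le_of_dvd hpos hdvd) hQpos
    have hsq : p ^ (2 * e) - 1 = (p ^ e - 1) * (p ^ e + 1) := by
      rw [mul_comm (p ^ e - 1), mul_comm 2 e, pow_mul, ← Nat.sq_sub_sq, one_pow]
    have hdvd2 : (p ^ e - 1) * (p ^ e + 1) ∣ p ^ h - 1 :=
      hsq ▸ Nat.pow_sub_one_dvd_pow_sub_one p he
    -- Norm case: l = m = (q-1)/(p^e-1), which p^e+1 divides because p^(2e)-1 ∣ q-1.
    refine hmult _ ((p ^ h - 1) / (p ^ e - 1)) t dvd_rfl (Nat.div_dvd_of_dvd hdvd) hmy.symm.dvd ?_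
      ?_ ?_ ?_
    · refine ht.trans ((Nat.le_div_iff_mul_le hypos).mpr ?_)
      rw [mul_comm, hmy]
    · refine Dvd.dvd.mul_left ?_ t
      refine Nat.dvd_of_mul_dvd_mul_left hQpos ?_
      rwa [mul_comm _ (_ / _), hmy]
    · rw [hN, Nat.mul_div_assoc t hdvd]
    · rw [hK, hsq, ← Nat.div_div_eq_div_mul, Nat.mul_div_assoc t hdvd]
  · set M := p ^ h - 1
    have hlcm' : M ∣ Nat.lcm (Nat.gcd x₁ M) (Nat.gcd x₂ M) :=
      dvd_lcm_gcd_gcd hpos hlcm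
    have hg : Nat.gcd x₂ M ∣ Nat.gcd x₁ M * (p ^ e - 1) := by
      rw [← Nat.gcd_mul_right]
      exact Nat.dvd_gcd hx ((Nat.gcd_dvd_right _ _).mul_right _)
    -- Here l = gcd(x₁, q-1) and m = r₂.
    exact hmult (Nat.gcd x₁ M) _ r₁ (div_dvd_of_dvd_lcm (Nat.gcd_dvd_right _ _) hpos hlcm')
      (Nat.gcd_dvd_right _ _) (hlcm'.trans (Nat.lcm_dvd (Dvd.intro _ rfl) hg)) hr₁ hdiv hN hK
  · set M := p ^ h - 1
    set y := M / (p ^ e - 1)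
    have hmy : y * (p ^ e - 1) = M := Nat.div_mul_cancel hdvd
    have hypos : 0 < y := Nat.div_pos (Nat.le_of_dvd hpos hdvd) hQpos
    have hlM : Nat.lcm m y ∣ M := Nat.lcm_dvd hm (Nat.div_dvd_of_dvd hdvd)
    -- Here l = lcm(m, y) = y·m₁, so (q-1)/l = (p^e-1)/m₁.
    refine hmult (Nat.lcm m y) m r (Nat.dvd_lcm_left _ _) hlM ?_ (hr.trans_eq ?_) hdiv hN hK
    · rw [← hmy]
      exact Nat.mul_dvd_mul_right (Nat.dvd_lcm_right m y) _
    · rw [← hmy, Nat.lcm, mul_comm m y, Nat.mul_div_assoc y (Nat.gcd_dvd_left m y),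
        Nat.mul_div_mul_left _ _ hypos]
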